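/- Let the integers $\mathrm{pod}_{-3}(n)$, $n\ge 0$, be defined by the generating function \[\sum_{n=0}^{\infty}\mathrm{pod}_{-3}(n)q^n=\frac{(-q;q^2)_\infty^3}{(q^2;q^2)_\infty^3},\qquad (a;q)_\infty=\prod_{i=0}^{\infty}(1-aq^i).\] Then for all integers $\alpha\ge 1$ and $n\ge 0$, \[\mathrm{pod}_{-3}\Big(3^{2\alpha+2}n+\frac{23\cdot 3^{2\alpha+1}+3}{8}\Big)\equiv 0\pmod 9.\] -/

import Mathlib

section PodDefs

open PowerSeries Filter Topology
open scoped PowerSeries.WithPiTopology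

/-- The `q`-Pochhammer symbol `(a; q)_∞ = ∏_{i ≥ 0} (1 - a q ^ i)` for formal power series `a, q`
over `ℤ`, as an infinite product in the topology of coefficientwise convergence.
It is used only when `a` and `q` have constant term `0`, and then the product converges. -/
noncomputable def qPochInf (a q : ℤ⟦X⟧) : ℤ⟦X⟧ := ∏' i : ℕ, (1 - a * q ^ i)

theorem multipliable_qPochInf {a q : ℤ⟦X⟧} (hq : constantCoeff q = 0) :
    Multipliable fun i : ℕ ↦ (1 - a * q ^ i : ℤ⟦X⟧) := by
  simp_rw [sub_eq_add_neg]
  apply PowerSeries.WithPiTopology.multipliable_one_add_of_tendsto_order_atTop_nhds_top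
  refine ENat.tendsto_nhds_top_iff_natCast_lt.mpr
    (fun n ↦ Filter.eventually_atTop.mpr ⟨n + 1, fun m hm ↦ ?_⟩)
  rw [order_neg]
  have h1 : (m : ℕ∞) ≤ (q ^ m).order := by
    apply le_order
    intro i hi
    exact coeff_of_lt_order i (lt_of_lt_of_le hi (by
      have := le_order_pow_of_constantCoeff_eq_zero m hq
      exact_mod_cast this))
  calc (n : ℕ∞) < m := by exact_mod_cast hm
    _ ≤ (q ^ m).order := h1
    _ ≤ a.order + (q ^ m).order := le_add_self
    _ ≤ (a * q ^ m).order := le_order_mul a (q ^ m)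

theorem constantCoeff_qPochInf {a q : ℤ⟦X⟧} (ha : constantCoeff a = 0)
    (hq : constantCoeff q = 0) : constantCoeff (qPochInf a q) = 1 := by
  rw [qPochInf, (multipliable_qPochInf hq).map_tprod _
    (PowerSeries.WithPiTopology.continuous_constantCoeff ℤ)]
  simp [ha]

/-- The generating function `(-q; q²)_∞ ^ k / (q²; q²)_∞ ^ k` over `ℤ`. -/
noncomputable def podGenFun (k : ℕ) : ℤ⟦X⟧ :=
  qPochInf (-X) (X ^ 2) ^ k * invOfUnit (qPochInf (X ^ 2) (X ^ 2) ^ k) 1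

/-- The denominator is invertible, so `podGenFun k` is the genuine quotient. -/
theorem podGenFun_mul (k : ℕ) :
    podGenFun k * qPochInf (X ^ 2) (X ^ 2) ^ k = qPochInf (-X) (X ^ 2) ^ k := by
  have h := mul_invOfUnit (qPochInf (X ^ 2) (X ^ 2) ^ k) 1 (by
    rw [map_pow, constantCoeff_qPochInf (by simp) (by simp)]; simp)
  rw [podGenFun, mul_assoc, mul_comm (invOfUnit _ _), h, mul_one]

/-- `podNeg k n` is `pod_{-k}(n)`, the coefficient of `q ^ n` in
`(-q; q²)_∞ ^ k / (q²; q²)_∞ ^ k`. -/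
noncomputable def podNeg (k n : ℕ) : ℤ := coeff n (podGenFun k)

/-- The division by `8` in the arithmetic progressions is exact. -/
theorem eight_dvd_progression_start (α : ℕ) : 8 ∣ 23 * 3 ^ (2 * α + 1) + 3 := by
  have h : 3 ^ (2 * α + 1) % 8 = 3 := by
    rw [pow_succ, pow_mul, Nat.mul_mod, Nat.pow_mod]; norm_num
  omega

end PodDefs

/-! By Gauss, `ψ(q) = (q²; q²)_∞ / (q; q²)_∞`, so replacing `q` by `-q` turns the generating
function into `1/ψ³` (`rescale_podGenFun_mul_psi_pow`). Write `ψ(q) = A(q³) + q ψ(q⁹)`. Taking the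
norm over `q ↦ ωq` gives `A³ + q ψ(q³)³ = ψ⁴ / ψ(q³)` (`psiZero_pow_three_add`). Modulo 9, `ψ⁹ ≡
ψ(q³)³`, so `1/ψ³ ≡ ψ⁶ / ψ(q³)³`; extracting exponents `3n` gives `ψ⁵ / ψ(q³)²`, and extracting `3n
+ 2` from that gives `ψ² ψ(q³)`. Hence, up to sign, `pod_{-3}(9K + 6)` is modulo 9 the number of
ways to write `8K + 5 = x² + y² + 3z²` with `x, y, z` odd and positive. In the given progression `8K
+ 5 = 3^(2α-1) (24n + 23)`, which a descent at 3 shows is not of this form. -/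

open PowerSeries Filter Topology
open scoped PowerSeries.WithPiTopology

/-! ### Finite form of Gauss' identity -/

section FiniteGauss

variable {R : Type*} [CommRing R]

/-- The partial product `(q; q²)_n`. -/
def oddProd (q : R) (n : ℕ) : R := ∏ i ∈ Finset.range n, (1 - q ^ (2 * i + 1))

/-- The partial product `(q²; q²)_n`. -/
def evenProd (q : R) (n : ℕ) : R := ∏ i ∈ Finset.range n, (1 - q ^ (2 * i + 2))

/-- The product `(q; q²)_s (q^{2s+2}; q²)_{n-s}`. -/
def mixedProd (q : R) (n s : ℕ) : R :=
  oddProd q s * ∏ i ∈ Finset.Ico s n, (1 - q ^ (2 * i + 2))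

theorem mixedProd_zero_right (q : R) (n : ℕ) : mixedProd q n 0 = evenProd q n := by
  simp [mixedProd, oddProd, evenProd]

theorem mixedProd_self (q : R) (n : ℕ) : mixedProd q n n = oddProd q n := by
  simp [mixedProd]

theorem mixedProd_succ_left (q : R) {n s : ℕ} (h : s ≤ n) :
    mixedProd q (n + 1) s = mixedProd q n s * (1 - q ^ (2 * n + 2)) := by
  rw [mixedProd, mixedProd, Finset.prod_Ico_succ_top h, mul_assoc]

theorem mixedProd_succ_right (q : R) {n s : ℕ} (h : s < n) :
    mixedProd q n (s + 1) * (1 - q ^ (2 * s + 2)) = mixedProd q n s * (1 - q ^ (2 * s + 1)) := by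
  rw [mixedProd, mixedProd, Finset.prod_eq_prod_Ico_succ_bot h, oddProd, oddProd,
    Finset.prod_range_succ]
  ring

theorem two_mul_triangle (n : ℕ) : 2 * (n * (n + 1) / 2) = n * (n + 1) :=
  Nat.mul_div_cancel' (even_iff_two_dvd.mp (Nat.even_mul_succ_self n))

/-- Each summand is the difference of consecutive values of the right-hand side. The case `m = n` is
the induction step of Shanks' identity. -/
theorem sum_mixedProd_telescope (q : R) (n : ℕ) {m : ℕ} (hm : m ≤ n) :
    ∑ s ∈ Finset.range m, (mixedProd q (n + 1) s * q ^ (s * (2 * n + 3))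
        - (1 - q ^ (2 * n + 1)) * (mixedProd q n s * q ^ (s * (2 * n + 1)))) =
      mixedProd q n m * q ^ (m * (2 * n + 1)) * (1 - q ^ (2 * m)) := by
  induction m with
  | zero => simp
  | succ m ih =>
    rw [Finset.sum_range_succ, ih (by omega), mixedProd_succ_left q (by omega : m ≤ n)]
    have h := mixedProd_succ_right q (by omega : m < n)
    linear_combination (-q ^ ((m + 1) * (2 * n + 1))) * h

/-- Shanks' finite form of Gauss' identity for triangular numbers. -/
theorem oddProd_mul_sum_triangle (q : R) (n : ℕ) :
    oddProd q n * ∑ j ∈ Finset.range (2 * n), q ^ (j * (j + 1) / 2) =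
      ∑ s ∈ Finset.range n, mixedProd q n s * q ^ (s * (2 * n + 1)) := by
  induction n with
  | zero => simp
  | succ n ih =>
    have h := sum_mixedProd_telescope q n le_rfl
    rw [Finset.sum_sub_distrib, ← Finset.mul_sum, ← ih] at h
    have e1 : 2 * n * (2 * n + 1) / 2 = n * (2 * n + 1) := by
      have := two_mul_triangle (2 * n); linarith
    have e2 : (2 * n + 1) * (2 * n + 1 + 1) / 2 = n * (2 * n + 1) + (2 * n + 1) := by
      have := two_mul_triangle (2 * n + 1); linarith
    have hb : oddProd q (n + 1) = oddProd q n * (1 - q ^ (2 * n + 1)) := by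
      rw [oddProd, oddProd, Finset.prod_range_succ]
    rw [mul_add_one 2 n, Finset.sum_range_succ, Finset.sum_range_succ, e1, e2,
      Finset.sum_range_succ, hb, show 2 * n + 2 + 1 = 2 * n + 3 from rfl]
    rw [mixedProd_self] at h
    rw [mixedProd_succ_left q le_rfl, mixedProd_self]
    linear_combination -h

/-- In Shanks' sum only the term `s = 0` is not divisible by a high power of `q`, and that term is
`evenProd q n`. -/
theorem pow_dvd_oddProd_mul_sum_sub (q : R) (n : ℕ) :
    q ^ (2 * n) ∣
      oddProd q n * ∑ j ∈ Finset.range (2 * n), q ^ (j * (j + 1) / 2) - evenProd q n := by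
  rw [oddProd_mul_sum_triangle]
  cases n with
  | zero => simp [evenProd]
  | succ n =>
    rw [Finset.sum_range_succ', mixedProd_zero_right, zero_mul, pow_zero, mul_one, add_sub_cancel_right]
    refine Finset.dvd_sum fun s _ ↦ Dvd.dvd.mul_left (pow_dvd_pow _ ?_) _
    exact (Nat.le_succ _).trans (Nat.le_mul_of_pos_left _ s.succ_pos)

end FiniteGauss

/-! ### The theta function `ψ` -/

section Psi

/-- Ramanujan's theta function `ψ(q) = ∑ q ^ (j (j + 1) / 2)` as a formal power series. -/
noncomputable def psi : ℤ⟦X⟧ :=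
  PowerSeries.mk fun n ↦ if IsSquare (8 * n + 1) then 1 else 0

theorem coeff_psi (n : ℕ) : coeff n psi = if IsSquare (8 * n + 1) then 1 else 0 := by
  simp [psi]

theorem isSquare_eight_mul_add_one_iff (n : ℕ) :
    IsSquare (8 * n + 1) ↔ ∃ j, j * (j + 1) / 2 = n := by
  constructor
  · rintro ⟨r, hr⟩
    have hodd : r % 2 = 1 := by
      rcases Nat.even_or_odd' r with ⟨k, rfl | rfl⟩
      · have : 2 * k * (2 * k) = 2 * (2 * k * k) := by ring
        omega
      · omega
    obtain ⟨k, rfl⟩ : ∃ k, r = 2 * k + 1 := ⟨r / 2, by omega⟩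
    refine ⟨k, ?_⟩
    have := two_mul_triangle k
    nlinarith
  · rintro ⟨j, rfl⟩
    refine ⟨2 * j + 1, ?_⟩
    have := two_mul_triangle j
    nlinarith

theorem triangle_strictMono : StrictMono fun j : ℕ ↦ j * (j + 1) / 2 := by
  refine strictMono_nat_of_lt_succ fun j ↦ ?_
  have h1 := two_mul_triangle j
  have h2 := two_mul_triangle (j + 1)
  change j * (j + 1) / 2 < (j + 1) * (j + 1 + 1) / 2
  nlinarith

theorem X_pow_dvd_psi_sub_sum (n : ℕ) :
    X ^ n ∣ psi - ∑ j ∈ Finset.range n, (X : ℤ⟦X⟧) ^ (j * (j + 1) / 2) := by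
  rw [X_pow_dvd_iff]
  intro m hm
  rw [map_sub, map_sum, coeff_psi]
  simp only [coeff_X_pow]
  by_cases h : ∃ j, j * (j + 1) / 2 = m
  · rw [if_pos ((isSquare_eight_mul_add_one_iff m).mpr h)]
    obtain ⟨j, hj⟩ := h
    rw [Finset.sum_eq_single j, if_pos hj.symm, sub_self]
    · intro i _ hi
      rw [if_neg]
      rintro rfl
      exact hi (triangle_strictMono.injective hj.symm)
    · intro hj'
      have : j ≤ j * (j + 1) / 2 := triangle_strictMono.le_apply
      rw [Finset.mem_range] at hj'
      omega
  · rw [if_neg (mt (isSquare_eight_mul_add_one_iff m).mp h), Finset.sum_eq_zero, sub_zero]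
    intro j _
    rw [if_neg]
    rintro rfl
    exact h ⟨j, rfl⟩

end Psi

/-! ### Infinite products and Gauss' identity -/

section Products

theorem PowerSeries.continuous_rescale {R : Type*} [CommSemiring R] [TopologicalSpace R]
    [IsTopologicalSemiring R] (a : R) : Continuous (rescale a : R⟦X⟧ → R⟦X⟧) := by
  rw [continuous_iff_continuousAt]
  intro f
  refine (WithPiTopology.tendsto_iff_coeff_tendsto R _ _ _).mpr fun d ↦ ?_
  simp_rw [coeff_rescale]
  exact (((WithPiTopology.continuous_coeff R d).tendsto f).const_mul _)

theorem PowerSeries.continuous_expand {R : Type*} [CommRing R] [TopologicalSpace R] (p : ℕ)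
    (hp : p ≠ 0) : Continuous (expand p hp : R⟦X⟧ → R⟦X⟧) := by
  rw [continuous_iff_continuousAt]
  intro f
  refine (WithPiTopology.tendsto_iff_coeff_tendsto R _ _ _).mpr fun d ↦ ?_
  simp_rw [coeff_expand]
  split_ifs
  · exact (WithPiTopology.continuous_coeff R _).tendsto f
  · exact tendsto_const_nhds

theorem PowerSeries.continuous_map {R S : Type*} [Semiring R] [TopologicalSpace R] [Semiring S]
    [TopologicalSpace S] (φ : R →+* S) (hφ : Continuous φ) :
    Continuous (PowerSeries.map φ : R⟦X⟧ → S⟦X⟧) := by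
  rw [continuous_iff_continuousAt]
  intro f
  refine (WithPiTopology.tendsto_iff_coeff_tendsto S _ _ _).mpr fun d ↦ ?_
  simp_rw [coeff_map]
  exact (hφ.tendsto _).comp ((WithPiTopology.continuous_coeff R d).tendsto f)

theorem PowerSeries.expand_injective {R : Type*} [CommRing R] (p : ℕ) (hp : p ≠ 0) :
    Function.Injective (expand p hp : R⟦X⟧ → R⟦X⟧) := by
  intro f g h
  ext n
  simpa using congrArg (coeff (p * n)) h

/-- The infinite product `(q; q²)_∞`. -/
noncomputable def oddProdInf : ℤ⟦X⟧ := rescale (-1) (qPochInf (-X) (X ^ 2))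

/-- The infinite product `(q²; q²)_∞`. -/
noncomputable def evenProdInf : ℤ⟦X⟧ := rescale (-1) (qPochInf (X ^ 2) (X ^ 2))

theorem tendsto_qPochInf {a q : ℤ⟦X⟧} (hq : constantCoeff q = 0) :
    Tendsto (fun n ↦ ∏ i ∈ Finset.range n, (1 - a * q ^ i)) atTop (𝓝 (qPochInf a q)) :=
  (multipliable_qPochInf hq).hasProd.tendsto_prod_nat

theorem tendsto_oddProd : Tendsto (oddProd (X : ℤ⟦X⟧)) atTop (𝓝 oddProdInf) := by
  refine (((continuous_rescale (-1 : ℤ)).tendsto _).comp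
    (tendsto_qPochInf (a := -X) (q := X ^ 2) (by simp))).congr fun n ↦ ?_
  simp only [Function.comp_apply, map_prod, oddProd]
  refine Finset.prod_congr rfl fun i _ ↦ ?_
  simp only [map_sub, map_mul, map_neg, map_pow, map_one, rescale_neg_one_X]
  ring

theorem tendsto_evenProd : Tendsto (evenProd (X : ℤ⟦X⟧)) atTop (𝓝 evenProdInf) := by
  refine (((continuous_rescale (-1 : ℤ)).tendsto _).comp
    (tendsto_qPochInf (a := X ^ 2) (q := X ^ 2) (by simp))).congr fun n ↦ ?_
  simp only [Function.comp_apply, map_prod, evenProd]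
  refine Finset.prod_congr rfl fun i _ ↦ ?_
  simp only [map_sub, map_mul, map_pow, map_one, rescale_neg_one_X]
  ring

theorem oddProdInf_ne_zero : oddProdInf ≠ 0 := by
  intro h
  have := congrArg (coeff 0) h
  rw [oddProdInf, coeff_rescale, coeff_zero_eq_constantCoeff_apply,
    constantCoeff_qPochInf (by simp) (by simp)] at this
  simp at this

/-- Gauss' identity `ψ(q) (q; q²)_∞ = (q²; q²)_∞`. -/
theorem oddProdInf_mul_psi : oddProdInf * psi = evenProdInf := by
  have key (n : ℕ) : X ^ n ∣ oddProd (X : ℤ⟦X⟧) n * psi - evenProd X n := by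
    have h1 := (pow_dvd_pow (X : ℤ⟦X⟧) (by omega : n ≤ 2 * n)).trans
      (pow_dvd_oddProd_mul_sum_sub X n)
    have h2 := (pow_dvd_pow (X : ℤ⟦X⟧) (by omega : n ≤ 2 * n)).trans
      ((X_pow_dvd_psi_sub_sum (2 * n)).mul_left (oddProd X n))
    convert dvd_add h1 h2 using 1
    ring
  have hlim : Tendsto (fun n ↦ oddProd (X : ℤ⟦X⟧) n * psi - evenProd X n) atTop (𝓝 0) := by
    refine (WithPiTopology.tendsto_iff_coeff_tendsto ℤ _ _ _).mpr fun d ↦ ?_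
    refine tendsto_const_nhds.congr' ?_
    filter_upwards [eventually_gt_atTop d] with n hn
    rw [X_pow_dvd_iff.mp (key n) d hn, map_zero]
  exact sub_eq_zero.mp (tendsto_nhds_unique
    ((tendsto_oddProd.mul_const psi).sub tendsto_evenProd) hlim)

/-- Up to the sign of `q`, the series `podGenFun 3` is the inverse of `ψ(q) ^ 3`. -/
theorem rescale_podGenFun_mul_psi_pow : rescale (-1) (podGenFun 3) * psi ^ 3 = 1 := by
  have h := congrArg (rescale (-1)) (podGenFun_mul 3)
  rw [map_mul, map_pow, map_pow] at h
  change _ * evenProdInf ^ 3 = oddProdInf ^ 3 at h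
  rw [← oddProdInf_mul_psi] at h
  refine mul_left_cancel₀ (pow_ne_zero 3 oddProdInf_ne_zero) ?_
  linear_combination h

end Products

/-! ### The norm over cube roots of unity -/

section CubicNorm

/-- The norm `f(q) f(ωq) f(ω²q)`. -/
noncomputable def cubicNorm {K : Type*} [CommRing K] (ω : K) : K⟦X⟧ →* K⟦X⟧ where
  toFun f := f * rescale ω f * rescale (ω ^ 2) f
  map_one' := by simp
  map_mul' f g := by simp only [map_mul]; ring

variable {K : Type*} [CommRing K] {ω : K}

theorem cubicNorm_apply (f : K⟦X⟧) :
    cubicNorm ω f = f * rescale ω f * rescale (ω ^ 2) f := rfl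

theorem rescale_expand_three {a : K} (ha : a ^ 3 = 1) (f : K⟦X⟧) :
    rescale a (expand 3 three_ne_zero f) = expand 3 three_ne_zero f := by
  ext n
  rw [coeff_rescale, coeff_expand]
  split_ifs with h
  · obtain ⟨m, rfl⟩ := h
    rw [pow_mul, ha, one_pow, one_mul]
  · rw [mul_zero]

theorem cubicNorm_expand_three (hω : 1 + ω + ω ^ 2 = 0) (f : K⟦X⟧) :
    cubicNorm ω (expand 3 three_ne_zero f) = expand 3 three_ne_zero f ^ 3 := by
  have h3 : ω ^ 3 = 1 := by linear_combination (ω - 1) * hω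
  have h6 : (ω ^ 2) ^ 3 = 1 := by linear_combination (ω ^ 3 + 1) * h3
  rw [cubicNorm_apply, rescale_expand_three h3, rescale_expand_three h6]
  ring

theorem cubicNorm_add_X_mul (hω : 1 + ω + ω ^ 2 = 0) (f g : K⟦X⟧) :
    cubicNorm ω (expand 3 three_ne_zero f + X * expand 3 three_ne_zero g) =
      expand 3 three_ne_zero (f ^ 3 + X * g ^ 3) := by
  have h3 : ω ^ 3 = 1 := by linear_combination (ω - 1) * hω
  have h6 : (ω ^ 2) ^ 3 = 1 := by linear_combination (ω ^ 3 + 1) * h3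
  have hC : 1 + C ω + C ω ^ 2 = (0 : K⟦X⟧) := by
    rw [← map_pow, ← map_one C, ← map_add, ← map_add, hω, map_zero]
  have hC3 : C ω ^ 3 = (1 : K⟦X⟧) := by rw [← map_pow, h3, map_one]
  simp only [cubicNorm_apply, map_add, map_mul, map_pow, rescale_expand_three h3,
    rescale_expand_three h6, rescale_X, expand_X]
  generalize expand 3 three_ne_zero f = a
  generalize expand 3 three_ne_zero g = b
  linear_combination (a ^ 2 * X * b + a * X ^ 2 * b ^ 2 * C ω) * hC + X ^ 3 * b ^ 3 * hC3

/-- For `m` prime to 3, `ω ↦ ω^m` permutes `1, ω, ω²`, and `(1 - y)(1 - ωy)(1 - ω²y) = 1 - y³`. -/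
theorem cubicNorm_one_sub_X_pow (hω : 1 + ω + ω ^ 2 = 0) {m : ℕ} (hm : m % 3 ≠ 0) :
    cubicNorm ω (1 - X ^ m) = 1 - X ^ (3 * m) := by
  have h3 : ω ^ 3 = 1 := by linear_combination (ω - 1) * hω
  have hC : 1 + C ω + C ω ^ 2 = (0 : K⟦X⟧) := by
    rw [← map_pow, ← map_one C, ← map_add, ← map_add, hω, map_zero]
  have hC3 : C ω ^ 3 = (1 : K⟦X⟧) := by rw [← map_pow, h3, map_one]
  have hm' : C ω ^ m = C ω ^ (m % 3) := by
    conv_lhs => rw [← Nat.div_add_mod m 3, pow_add, pow_mul, hC3, one_pow, one_mul]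
  simp only [cubicNorm_apply, map_sub, map_one, map_pow, rescale_X, mul_pow, pow_right_comm _ 2 m,
    hm', pow_mul (X : K⟦X⟧) 3 m, pow_right_comm (X : K⟦X⟧) 3 m]
  rcases (by omega : m % 3 = 1 ∨ m % 3 = 2) with h | h <;> rw [h] <;> generalize (X : K⟦X⟧) ^ m = y
  · linear_combination (-y + y ^ 2 * C ω) * hC - y ^ 3 * hC3
  · linear_combination (-y + y ^ 2 * C ω ^ 2) * hC + (-y * C ω + y ^ 2 * C ω ^ 3) * hC3
      - y ^ 3 * (C ω ^ 3 + 1) * hC3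

end CubicNorm

/-! ### The norm relation for the products and for `ψ` -/

section NormOfProducts

variable {K : Type*} [CommRing K] {ω : K}

theorem cubicNorm_one_sub_X_pow_three_mul (hω : 1 + ω + ω ^ 2 = 0) (m : ℕ) :
    cubicNorm ω (1 - X ^ (3 * m)) = (1 - X ^ (3 * m)) ^ 3 := by
  have h := cubicNorm_expand_three hω (1 - X ^ m)
  rwa [map_sub, map_one, map_pow, expand_X, ← pow_mul] at h

/-- Among three consecutive odd exponents one is a multiple of 3; its factor has norm `(1 - q^m)³`
instead of `1 - q^(3m)`, and the extra product on the left restores the missing `1 - q^(3m)`. -/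
theorem cubicNorm_oddProd (hω : 1 + ω + ω ^ 2 = 0) (n : ℕ) :
    cubicNorm ω (oddProd X (3 * n)) * oddProd ((X ^ 3) ^ 3) n =
      oddProd (X ^ 3) (3 * n) * oddProd (X ^ 3) n ^ 3 := by
  induction n with
  | zero => simp [oddProd]
  | succ n ih =>
    simp only [oddProd, mul_add_one 3 n, Finset.prod_range_succ, map_mul] at ih ⊢
    rw [cubicNorm_one_sub_X_pow hω (by omega : (2 * (3 * n) + 1) % 3 ≠ 0),
      cubicNorm_one_sub_X_pow hω (by omega : (2 * (3 * n + 2) + 1) % 3 ≠ 0),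
      show 2 * (3 * n + 1) + 1 = 3 * (2 * n + 1) by ring, cubicNorm_one_sub_X_pow_three_mul hω]
    simp only [← pow_mul] at ih ⊢
    rw [show 3 * 3 * (2 * n + 1) = 3 * (3 * (2 * n + 1)) by ring]
    linear_combination (1 - X ^ (3 * (2 * (3 * n) + 1))) * (1 - X ^ (3 * (2 * n + 1))) ^ 3 *
      (1 - X ^ (3 * (2 * (3 * n + 2) + 1))) * (1 - X ^ (3 * (3 * (2 * n + 1)))) * ih

theorem cubicNorm_evenProd (hω : 1 + ω + ω ^ 2 = 0) (n : ℕ) :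
    cubicNorm ω (evenProd X (3 * n)) * evenProd ((X ^ 3) ^ 3) n =
      evenProd (X ^ 3) (3 * n) * evenProd (X ^ 3) n ^ 3 := by
  induction n with
  | zero => simp [evenProd]
  | succ n ih =>
    simp only [evenProd, mul_add_one 3 n, Finset.prod_range_succ, map_mul] at ih ⊢
    rw [cubicNorm_one_sub_X_pow hω (by omega), cubicNorm_one_sub_X_pow hω (by omega),
      show 2 * (3 * n + 2) + 2 = 3 * (2 * n + 2) by ring, cubicNorm_one_sub_X_pow_three_mul hω]
    simp only [← pow_mul] at ih ⊢
    rw [show 3 * 3 * (2 * n + 2) = 3 * (3 * (2 * n + 2)) by ring]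
    linear_combination (1 - X ^ (3 * (2 * (3 * n) + 2))) * (1 - X ^ (3 * (2 * n + 2))) ^ 3 *
      (1 - X ^ (3 * (2 * (3 * n + 1) + 2))) * (1 - X ^ (3 * (3 * (2 * n + 2)))) * ih

theorem continuous_cubicNorm [TopologicalSpace K] [IsTopologicalRing K] (ω : K) :
    Continuous (cubicNorm ω) :=
  (continuous_id.mul (continuous_rescale ω)).mul (continuous_rescale (ω ^ 2))

/-- The relation `F(q) F(ωq) F(ω²q) F(q⁹) = F(q³)⁴`. -/
def SatisfiesNormRelation (ω : ℂ) (F : ℂ⟦X⟧) : Prop :=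
  cubicNorm ω F * expand 3 three_ne_zero (expand 3 three_ne_zero F) =
    expand 3 three_ne_zero F ^ 4

theorem satisfiesNormRelation_of_tendsto {ω : ℂ} {F : ℂ⟦X⟧} {f : ℕ → ℂ⟦X⟧}
    (hf : Tendsto f atTop (𝓝 F))
    (h : ∀ n, cubicNorm ω (f (3 * n)) * expand 3 three_ne_zero (expand 3 three_ne_zero (f n)) =
      expand 3 three_ne_zero (f (3 * n)) * expand 3 three_ne_zero (f n) ^ 3) :
    SatisfiesNormRelation ω F := by
  have he := continuous_expand (R := ℂ) 3 three_ne_zero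
  have h3 : Tendsto (fun n : ℕ ↦ f (3 * n)) atTop (𝓝 F) :=
    hf.comp (tendsto_id.const_mul_atTop' three_pos)
  have h1 := (((continuous_cubicNorm ω).tendsto F).comp h3).mul
    (((he.comp he).tendsto F).comp hf)
  have h2 := ((he.tendsto F).comp h3).mul (((he.tendsto F).comp hf).pow 3)
  have := tendsto_nhds_unique (h1.congr h) h2
  simp only [Function.comp_apply] at this
  rw [SatisfiesNormRelation, this]
  ring

theorem continuous_map_intCast :
    Continuous (PowerSeries.map (Int.castRingHom ℂ) : ℤ⟦X⟧ → ℂ⟦X⟧) :=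
  continuous_map _ continuous_of_discreteTopology

theorem satisfiesNormRelation_oddProdInf {ω : ℂ} (hω : 1 + ω + ω ^ 2 = 0) :
    SatisfiesNormRelation ω (PowerSeries.map (Int.castRingHom ℂ) oddProdInf) := by
  refine satisfiesNormRelation_of_tendsto (f := oddProd X) ?_ fun n ↦ ?_
  · refine ((continuous_map_intCast.tendsto _).comp tendsto_oddProd).congr fun n ↦ ?_
    simp [oddProd]
  · simpa [oddProd] using cubicNorm_oddProd hω n

theorem satisfiesNormRelation_evenProdInf {ω : ℂ} (hω : 1 + ω + ω ^ 2 = 0) :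
    SatisfiesNormRelation ω (PowerSeries.map (Int.castRingHom ℂ) evenProdInf) := by
  refine satisfiesNormRelation_of_tendsto (f := evenProd X) ?_ fun n ↦ ?_
  · refine ((continuous_map_intCast.tendsto _).comp tendsto_evenProd).congr fun n ↦ ?_
    simp [evenProd]
  · simpa [evenProd] using cubicNorm_evenProd hω n

theorem map_intCast_injective :
    Function.Injective (PowerSeries.map (Int.castRingHom ℂ) : ℤ⟦X⟧ → ℂ⟦X⟧) :=
  PowerSeries.map_injective _ Int.cast_injective

/-- The relation is multiplicative in `F`, so it passes to the quotient of the two products. -/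
theorem satisfiesNormRelation_psi {ω : ℂ} (hω : 1 + ω + ω ^ 2 = 0) :
    SatisfiesNormRelation ω (PowerSeries.map (Int.castRingHom ℂ) psi) := by
  have hb := satisfiesNormRelation_oddProdInf hω
  have ha := satisfiesNormRelation_evenProdInf hω
  rw [← oddProdInf_mul_psi] at ha
  have hne : PowerSeries.map (Int.castRingHom ℂ) oddProdInf ≠ 0 := by
    rw [Ne, map_eq_zero_iff _ map_intCast_injective]
    exact oddProdInf_ne_zero
  have hne' : expand 3 three_ne_zero (PowerSeries.map (Int.castRingHom ℂ) oddProdInf) ≠ 0 := by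
    rw [Ne, map_eq_zero_iff _ (expand_injective 3 three_ne_zero)]
    exact hne
  simp only [SatisfiesNormRelation, map_mul] at ha hb ⊢
  refine mul_left_cancel₀ (pow_ne_zero 4 hne') ?_
  rw [← mul_pow, ← ha, ← hb]
  ring

end NormOfProducts

/-! ### The 3-dissection of `ψ` -/

section Dissection

/-- The series `A` with `ψ(q) = A(q³) + q ψ(q⁹)`. -/
noncomputable def psiZero : ℤ⟦X⟧ := PowerSeries.mk fun n ↦ coeff (3 * n) psi

/-- A square `8n + 1` is never 2 mod 3, which excludes `n ≡ 2`; for `n ≡ 1` it is divisible by 9,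
and dividing by 9 gives `8k + 1` with `n = 9k + 1`. -/
theorem psi_dissection :
    psi = expand 3 three_ne_zero psiZero +
      X * expand 3 three_ne_zero (expand 3 three_ne_zero psi) := by
  ext n
  obtain ⟨m, rfl | rfl | rfl⟩ : ∃ m, n = 3 * m ∨ n = 3 * m + 1 ∨ n = 3 * m + 2 :=
    ⟨n / 3, by omega⟩
  · have h : coeff (3 * m) (X * expand 3 three_ne_zero (expand 3 three_ne_zero psi)) = 0 := by
      rcases m with _ | m
      · simp
      · rw [show 3 * (m + 1) = 3 * m + 2 + 1 by ring, coeff_succ_X_mul,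
          coeff_expand_of_not_dvd _ _ _ (by omega)]
    rw [map_add, h, add_zero, coeff_expand_mul, psiZero, coeff_mk]
  · rw [map_add, coeff_expand_of_not_dvd _ _ _ (by omega), zero_add, coeff_succ_X_mul,
      coeff_expand_mul, coeff_expand, coeff_psi]
    split_ifs with h h' h'
    · obtain ⟨k, rfl⟩ := h'
      rw [Nat.mul_div_cancel_left k three_pos, coeff_psi, if_pos]
      obtain ⟨r, hr⟩ := h
      have h3 : 3 ∣ r := by
        refine Nat.prime_three.dvd_of_dvd_pow (n := 2) ?_
        rw [sq, ← hr]; omega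
      obtain ⟨s, rfl⟩ := h3
      exact ⟨s, by linarith⟩
    · exfalso
      obtain ⟨r, hr⟩ := h
      have h3 : 3 ∣ r := by
        refine Nat.prime_three.dvd_of_dvd_pow (n := 2) ?_
        rw [sq, ← hr]; omega
      obtain ⟨s, rfl⟩ := h3
      have : 3 * s * (3 * s) = 9 * (s * s) := by ring
      omega
    · obtain ⟨k, rfl⟩ := h'
      rw [Nat.mul_div_cancel_left k three_pos, coeff_psi, if_neg]
      rintro ⟨r, hr⟩
      exact h ⟨3 * r, by linarith⟩
    · rfl
  · rw [map_add, coeff_expand_of_not_dvd _ _ _ (by omega), zero_add, coeff_succ_X_mul,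
      coeff_expand_of_not_dvd _ _ _ (by omega), coeff_psi, if_neg]
    rintro ⟨r, hr⟩
    have h := congrArg (· % 3) hr
    simp only [Nat.mul_mod r r] at h
    rcases (by omega : r % 3 = 0 ∨ r % 3 = 1 ∨ r % 3 = 2) with h' | h' | h' <;>
      rw [h'] at h <;> omega

/-- Compares the norm of `ψ` computed from the dissection with the one from the product, then
replaces `q³` by `q`. -/
theorem psiZero_pow_three_add :
    (psiZero ^ 3 + X * expand 3 three_ne_zero psi ^ 3) * expand 3 three_ne_zero psi =
      psi ^ 4 := by
  obtain ⟨ω, hω⟩ : ∃ ω : ℂ, 1 + ω + ω ^ 2 = 0 := by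
    have hp := Complex.isPrimitiveRoot_exp 3 three_ne_zero
    have := hp.geom_sum_eq_zero (by norm_num)
    exact ⟨_, by simpa [Finset.sum_range_succ] using this⟩
  apply expand_injective 3 three_ne_zero
  apply map_intCast_injective
  have h := satisfiesNormRelation_psi hω
  have h2 : cubicNorm ω (PowerSeries.map (Int.castRingHom ℂ) psi) =
      PowerSeries.map (Int.castRingHom ℂ) (expand 3 three_ne_zero
        (psiZero ^ 3 + X * expand 3 three_ne_zero psi ^ 3)) := by
    conv_lhs => rw [psi_dissection]
    rw [map_add, map_mul, map_expand, map_expand, map_X, cubicNorm_add_X_mul hω]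
    simp
  rw [SatisfiesNormRelation, h2] at h
  simpa using h

end Dissection

/-! ### Frobenius congruences modulo 3 and 9 -/

section Frobenius

theorem expand_prime_eq_pow {p : ℕ} [hp : Fact p.Prime] (f : (ZMod p)⟦X⟧) :
    expand p hp.out.ne_zero f = f ^ p := by
  have h := MvPowerSeries.map_frobenius_expand p hp.out.ne_zero (f := f)
  rw [ZMod.frobenius_zmod, MvPowerSeries.map_id] at h
  exact h

theorem exists_pow_three_eq (f : ℤ⟦X⟧) :
    ∃ g : ℤ⟦X⟧, f ^ 3 = expand 3 three_ne_zero f + 3 * g := by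
  have h (n : ℕ) : (3 : ℤ) ∣ coeff n (f ^ 3 - expand 3 three_ne_zero f) := by
    rw [← Nat.cast_ofNat (R := ℤ), ← ZMod.intCast_zmod_eq_zero_iff_dvd]
    have := expand_prime_eq_pow (p := 3) (PowerSeries.map (Int.castRingHom (ZMod 3)) f)
    rw [← map_expand, ← map_pow] at this
    have := congrArg (coeff n) this
    rw [coeff_map, coeff_map] at this
    simpa [sub_eq_zero] using this.symm
  choose c hc using h
  refine ⟨PowerSeries.mk c, ?_⟩
  rw [← sub_eq_iff_eq_add']
  ext n
  rw [hc, show (3 : ℤ⟦X⟧) = C 3 from (map_ofNat C 3).symm, coeff_C_mul, coeff_mk]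

theorem nine_eq_zero : (9 : (ZMod 9)⟦X⟧) = 0 := by
  rw [← map_ofNat C 9, show (OfNat.ofNat 9 : ZMod 9) = 0 from rfl, map_zero]

theorem map_zmod_nine_pow_nine (f : ℤ⟦X⟧) :
    PowerSeries.map (Int.castRingHom (ZMod 9)) f ^ 9 =
      expand 3 three_ne_zero (PowerSeries.map (Int.castRingHom (ZMod 9)) f) ^ 3 := by
  obtain ⟨g, hg⟩ := exists_pow_three_eq f
  rw [← map_expand, ← map_pow, ← map_pow, show 9 = 3 * 3 from rfl, pow_mul, hg]
  have h9 := nine_eq_zero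
  generalize expand 3 three_ne_zero f = e
  simp only [map_pow, map_add, map_mul, map_ofNat]
  -- `(e + 3g)³ - e³ = 9 (e²g + 3eg² + 3g³)`.
  linear_combination (PowerSeries.map (Int.castRingHom (ZMod 9)) e ^ 2 *
    PowerSeries.map (Int.castRingHom (ZMod 9)) g +
    3 * PowerSeries.map (Int.castRingHom (ZMod 9)) e *
      PowerSeries.map (Int.castRingHom (ZMod 9)) g ^ 2 +
    3 * PowerSeries.map (Int.castRingHom (ZMod 9)) g ^ 3) * h9

end Frobenius

/-! ### Extracting residue classes of exponents mod 3 -/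

section Sections

variable {R : Type*} [CommRing R]

/-- The series whose `n`-th coefficient is the coefficient of `q ^ (3 n + r)` in `f`. -/
noncomputable def trisection (r : ℕ) (f : R⟦X⟧) : R⟦X⟧ :=
  PowerSeries.mk fun n ↦ coeff (3 * n + r) f

theorem coeff_trisection (r n : ℕ) (f : R⟦X⟧) :
    coeff n (trisection r f) = coeff (3 * n + r) f := coeff_mk _ _

theorem coeff_X_pow_mul_expand {i r : ℕ} (hi : i < 3) (hr : r < 3) (n : ℕ) (f : R⟦X⟧) :
    coeff (3 * n + r) (X ^ i * expand 3 three_ne_zero f) = if i = r then coeff n f else 0 := by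
  rw [coeff_X_pow_mul', coeff_expand]
  split_ifs with h1 h2 h3 h3 h3
  · rw [show (3 * n + r - i) / 3 = n by omega]
  · omega
  · omega
  · rfl
  · omega
  · rfl

theorem eq_sum_trisection (f : R⟦X⟧) :
    f = expand 3 three_ne_zero (trisection 0 f) + X * expand 3 three_ne_zero (trisection 1 f) +
      X ^ 2 * expand 3 three_ne_zero (trisection 2 f) := by
  suffices h : f = X ^ 0 * expand 3 three_ne_zero (trisection 0 f) +
      X ^ 1 * expand 3 three_ne_zero (trisection 1 f) +
      X ^ 2 * expand 3 three_ne_zero (trisection 2 f) by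
    simpa only [pow_zero, one_mul, pow_one] using h
  ext n
  obtain ⟨m, r, hr, rfl⟩ : ∃ m r, r < 3 ∧ n = 3 * m + r :=
    ⟨n / 3, n % 3, Nat.mod_lt _ three_pos, (Nat.div_add_mod n 3).symm⟩
  rw [map_add, map_add, coeff_X_pow_mul_expand (by omega) hr, coeff_X_pow_mul_expand (by omega) hr,
    coeff_X_pow_mul_expand (by omega) hr]
  interval_cases r <;> simp [coeff_trisection]

theorem trisection_of_eq {f g₀ g₁ g₂ : R⟦X⟧}
    (h : f = expand 3 three_ne_zero g₀ + X * expand 3 three_ne_zero g₁ +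
      X ^ 2 * expand 3 three_ne_zero g₂) :
    trisection 0 f = g₀ ∧ trisection 2 f = g₂ := by
  replace h : f = X ^ 0 * expand 3 three_ne_zero g₀ + X ^ 1 * expand 3 three_ne_zero g₁ +
      X ^ 2 * expand 3 three_ne_zero g₂ := by
    simpa only [pow_zero, one_mul, pow_one] using h
  constructor <;> ext n <;>
  rw [coeff_trisection, h, map_add, map_add, coeff_X_pow_mul_expand (by omega) (by omega),
    coeff_X_pow_mul_expand (by omega) (by omega), coeff_X_pow_mul_expand (by omega) (by omega)] <;>
  simp

theorem trisection_mul_expand (f g : R⟦X⟧) :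
    trisection 0 (f * expand 3 three_ne_zero g) = trisection 0 f * g ∧
      trisection 2 (f * expand 3 three_ne_zero g) = trisection 2 f * g := by
  apply trisection_of_eq (g₁ := trisection 1 f * g)
  conv_lhs => rw [eq_sum_trisection f]
  simp only [map_mul]
  ring

end Sections

/-! ### The generating function of `9K + 6` modulo 9 -/

section Congruence

/-- Abstract form of the two-step 3-dissection modulo `9` of `1 / ψ(q)³`. -/
theorem trisection_two_trisection_zero {R : Type*} [CommRing R] (h9' : (9 : R⟦X⟧) = 0)
    {G P A : R⟦X⟧} (hG : G * P ^ 3 = 1)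
    (h9 : P ^ 9 = expand 3 three_ne_zero P ^ 3)
    (hP : P = expand 3 three_ne_zero A + X * expand 3 three_ne_zero (expand 3 three_ne_zero P))
    (hA : (A ^ 3 + X * expand 3 three_ne_zero P ^ 3) * expand 3 three_ne_zero P = P ^ 4) :
    trisection 2 (trisection 0 G) = P ^ 2 * expand 3 three_ne_zero P := by
  have hX : expand 3 three_ne_zero (X : R⟦X⟧) = X ^ 3 := expand_X 3 three_ne_zero
  have hu : IsUnit P := by
    refine IsUnit.of_mul_eq_one (G * P ^ 2) ?_
    linear_combination hG
  have h0 : trisection 0 (P ^ 6) = (A ^ 3 + X * expand 3 three_ne_zero P ^ 3) ^ 2 := by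
    set H := expand 3 three_ne_zero P
    -- Binomial expansion of `(A(q³) + q H(q³))⁶`; the middle coefficient 20 becomes 2 modulo 9,
    -- completing a square.
    refine (trisection_of_eq (g₁ := 6 * A ^ 5 * H + 15 * X * A ^ 2 * H ^ 4)
      (g₂ := 15 * A ^ 4 * H ^ 2 + 6 * X * A * H ^ 5) ?_).1
    rw [hP]
    simp only [map_add, map_mul, map_pow, hX, map_ofNat]
    linear_combination (2 * X ^ 3 * expand 3 three_ne_zero A ^ 3 *
      expand 3 three_ne_zero H ^ 3) * h9'
  have h2 : trisection 2 (P ^ 5) =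
      (A ^ 3 + X * expand 3 three_ne_zero P ^ 3) * expand 3 three_ne_zero P ^ 2 := by
    set H := expand 3 three_ne_zero P
    -- Here the coefficient 10 of `A³H²` becomes 1 modulo 9.
    refine (trisection_of_eq (g₀ := A ^ 5 + 10 * X * A ^ 2 * H ^ 3)
      (g₁ := 5 * A ^ 4 * H + 5 * X * A * H ^ 4) ?_).2
    rw [hP]
    simp only [map_add, map_mul, map_pow, hX, map_ofNat]
    linear_combination (X ^ 2 * expand 3 three_ne_zero A ^ 3 *
      expand 3 three_ne_zero H ^ 2) * h9'
  have e0 : trisection 0 G * P ^ 3 = (A ^ 3 + X * expand 3 three_ne_zero P ^ 3) ^ 2 := by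
    rw [← h0, ← (trisection_mul_expand G (P ^ 3)).1, map_pow, ← h9]
    congr 1
    linear_combination P ^ 6 * hG
  have e0' : trisection 0 G * expand 3 three_ne_zero P ^ 2 = P ^ 5 := by
    refine (hu.pow 3).mul_right_cancel ?_
    linear_combination expand 3 three_ne_zero P ^ 2 * e0 +
      ((A ^ 3 + X * expand 3 three_ne_zero P ^ 3) * expand 3 three_ne_zero P + P ^ 4) * hA
  have e2 := (trisection_mul_expand (trisection 0 G) (P ^ 2)).2
  rw [map_pow, e0', h2] at e2
  refine (hu.pow 2).mul_right_cancel ?_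
  linear_combination -e2 + expand 3 three_ne_zero P * hA

theorem intCast_coeff_rescale_podGenFun (K : ℕ) :
    ((coeff (9 * K + 6) (rescale (-1) (podGenFun 3)) : ℤ) : ZMod 9) =
      ((coeff K (psi ^ 2 * expand 3 three_ne_zero psi) : ℤ) : ZMod 9) := by
  let φ := PowerSeries.map (Int.castRingHom (ZMod 9))
  have h := trisection_two_trisection_zero nine_eq_zero (G := φ (rescale (-1) (podGenFun 3))) (P := φ psi)
    (A := φ psiZero)
    (by rw [← map_pow, ← map_mul, rescale_podGenFun_mul_psi_pow, map_one])
    (map_zmod_nine_pow_nine psi)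
    (by simpa [φ] using congrArg φ psi_dissection)
    (by simpa [φ] using congrArg φ psiZero_pow_three_add)
  have h' := congrArg (coeff K) h
  rw [coeff_trisection, coeff_trisection, ← map_expand, ← map_pow, ← map_mul] at h'
  simp only [φ, coeff_map] at h'
  rw [show 9 * K + 6 = 3 * (3 * K + 2) + 0 by ring]
  exact h'

end Congruence

/-! ### Descent for `x² + y² + 3z²` -/

section Descent

theorem three_dvd_of_dvd_sq_add_sq {x y : ℤ} (h : 3 ∣ x ^ 2 + y ^ 2) : 3 ∣ x ∧ 3 ∣ y := by
  have key (z : ℤ) : z ^ 2 % 3 = 0 ∧ 3 ∣ z ∨ z ^ 2 % 3 = 1 := by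
    rcases (by omega : z % 3 = 0 ∨ z % 3 = 1 ∨ z % 3 = 2) with h | h | h
    · exact Or.inl ⟨by rw [pow_two, Int.mul_emod, h]; rfl, Int.dvd_of_emod_eq_zero h⟩
    · exact Or.inr (by rw [pow_two, Int.mul_emod, h]; rfl)
    · exact Or.inr (by rw [pow_two, Int.mul_emod, h]; rfl)
  rcases key x with ⟨hx, hx'⟩ | hx <;> rcases key y with ⟨hy, hy'⟩ | hy
  · exact ⟨hx', hy'⟩
  all_goals omega

/-- Since -1 is not a square mod 3, 3 divides `x` and `y`. For `a = 0` this leaves `z² ≡ 2` mod 3;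
otherwise 3 also divides `z`, and dividing by 9 lowers `a`. -/
theorem sq_add_sq_add_three_mul_sq_ne (a : ℕ) {m : ℤ} (hm : m % 3 = 2) (x y z : ℤ) :
    x ^ 2 + y ^ 2 + 3 * z ^ 2 ≠ 3 ^ (2 * a + 1) * m := by
  induction a generalizing x y z with
  | zero =>
    intro h
    obtain ⟨⟨x, rfl⟩, ⟨y, rfl⟩⟩ := three_dvd_of_dvd_sq_add_sq (x := x) (y := y)
      ⟨m - z ^ 2, by linear_combination h⟩
    have hz : z ^ 2 = m - 3 * (x ^ 2 + y ^ 2) := by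
      rw [mul_zero, zero_add, pow_one] at h
      linarith
    have h2 : z ^ 2 % 3 = 2 := by omega
    rw [pow_two, Int.mul_emod] at h2
    rcases (by omega : z % 3 = 0 ∨ z % 3 = 1 ∨ z % 3 = 2) with h' | h' | h' <;>
      rw [h'] at h2 <;> omega
  | succ a ih =>
    intro h
    rw [show 2 * (a + 1) + 1 = 2 * a + 1 + 2 by ring, pow_add] at h
    obtain ⟨⟨x, rfl⟩, ⟨y, rfl⟩⟩ := three_dvd_of_dvd_sq_add_sq (x := x) (y := y)
      ⟨3 ^ (2 * a + 1) * 3 * m - z ^ 2, by linear_combination h⟩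
    obtain ⟨z, rfl⟩ : 3 ∣ z := Int.prime_three.dvd_of_dvd_pow (n := 2)
      ⟨3 ^ (2 * a + 1) * m - x ^ 2 - y ^ 2, by linarith⟩
    exact ih x y z (by linarith)

theorem coeff_psi_sq_mul_expand_eq_zero {K a m : ℕ} (hm : m % 3 = 2)
    (hK : 8 * K + 5 = 3 ^ (2 * a + 1) * m) :
    coeff K (psi ^ 2 * expand 3 three_ne_zero psi) = 0 := by
  rw [coeff_mul]
  refine Finset.sum_eq_zero fun p hp ↦ ?_
  rw [pow_two, coeff_mul, Finset.sum_mul]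
  refine Finset.sum_eq_zero fun r hr ↦ ?_
  rw [coeff_expand]
  rw [Finset.HasAntidiagonal.mem_antidiagonal] at hp hr
  by_contra hne
  rw [coeff_psi, coeff_psi] at hne
  split_ifs at hne with h1 h2 h3
  all_goals try simp at hne
  rw [coeff_psi] at hne
  split_ifs at hne with h4
  all_goals try simp at hne
  obtain ⟨x, hx⟩ := h1
  obtain ⟨y, hy⟩ := h2
  obtain ⟨z, hz⟩ := h4
  obtain ⟨k, hk⟩ := h3
  rw [hk, Nat.mul_div_cancel_left k three_pos] at hz
  -- With `K = i + j + 3k`, the squares `8i + 1`, `8j + 1` and three times `8k + 1` add up to `8K +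
  -- 5`.
  refine sq_add_sq_add_three_mul_sq_ne a (m := m) (by omega) x y z ?_
  have : x * x + y * y + 3 * (z * z) = 3 ^ (2 * a + 1) * m := by omega
  zify at this
  linear_combination this

end Descent

theorem theorem2p4 (α n : ℕ) (hα : 1 ≤ α) :
    podNeg 3 (3 ^ (2 * α + 2) * n + (23 * 3 ^ (2 * α + 1) + 3) / 8) ≡ 0 [ZMOD 9] := by
  obtain ⟨a, rfl⟩ : ∃ a, α = a + 1 := ⟨α - 1, by omega⟩
  obtain ⟨c, hc⟩ := eight_dvd_progression_start (a + 1)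
  set N := 3 ^ (2 * (a + 1) + 2) * n + (23 * 3 ^ (2 * (a + 1) + 1) + 3) / 8 with hN
  have hN8 : 8 * N = 9 * (3 ^ (2 * a + 1) * (24 * n + 23)) + 3 := by
    rw [hN, hc, Nat.mul_div_cancel_left c (by norm_num), mul_add, ← hc]
    ring
  generalize ht : 3 ^ (2 * a + 1) * (24 * n + 23) = t at hN8
  -- `8N = 9t + 3` forces `N ≡ 6` mod 9, and then `8K + 5 = t`.
  obtain ⟨K, hK⟩ : ∃ K, N = 9 * K + 6 := ⟨N / 9, by omega⟩
  have h := intCast_coeff_rescale_podGenFun K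
  rw [coeff_psi_sq_mul_expand_eq_zero (a := a) (m := 24 * n + 23) (by omega) (by omega),
    ← hK, coeff_rescale, Int.cast_zero, ZMod.intCast_zmod_eq_zero_iff_dvd] at h
  exact Int.modEq_zero_iff_dvd.mpr
    ((IsUnit.dvd_mul_left ((isUnit_neg_one).pow N)).mp h)
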